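/- Let $A\in\mathbb{R}^{n\times n}$ have nonzero diagonal entries, write $A=C+D+E$ with $C$, $D$, $E$ the strictly lower triangular, diagonal and strictly upper triangular parts of $A$, and let $B_J:=-D^{-1}(C+E)$ be its Jacobi iteration matrix. Let $\rho(M)$ denote the spectral radius of a real square matrix $M$ (the maximal modulus of its complex eigenvalues). A \emph{splitting} of $B_J$ of order $d$ is a $d$-tuple $(B_1,\dots,B_d)$ of matrices in $\mathbb{R}^{n\times n}$ such that $B_p\neq O$ for all $p$, $B_J=\sum_{p=1}^d B_p$, and the Hadamard (entrywise) product $B_p\circ B_q$ is $O$ for all $p\neq q$. Its iteration matrix is the $dn\times dn$ matrix $$\mathcal{B}_{(d)}:=(\mathcal{I}_{(d)}-\mathcal{L}_{(d)})^{-1}\,\mathcal{U}_{(d)},$$ where $\mathcal{I}_{(d)}$ is the identity, $\mathcal{L}_{(d)}$ is the $d\times d$ block matrix whose $(p,q)$ block is $B_q$ if $q<p$ and $O$ otherwise, and $\mathcal{U}_{(d)}$ is the $d\times d$ block matrix whose $(p,q)$ block is $B_q$ if $q\ge p$ and $O$ otherwise. Suppose that $B_J\ge O$ elementwise and $\rho(B_J)>0$,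 and let $(B_1,\dots,B_d)$ be a splitting of $B_J$ of order $d\ge 2$. Then \begin{itemize} \item[(a1)] $\rho(B_J)<1 \iff \rho(\mathcal{B}_{(d)})<1$; \item[(a2)] $\rho(B_J)=1 \iff \rho(\mathcal{B}_{(d)})=1$; \item[(a3)] $\rho(B_J)>1 \iff \rho(\mathcal{B}_{(d)})>1$. \end{itemize} -/

import Mathlib

noncomputable section

namespace SplittingMethod

/-- The spectral radius `ρ(M)` of a real square matrix: the supremum (here a maximum) of the moduli
of its complex eigenvalues. -/
def rho {ι : Type*} [Fintype ι] [DecidableEq ι] (M : Matrix ι ι ℝ) : ENNReal :=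
  spectralRadius ℂ (M.map (algebraMap ℝ ℂ))

/-- The strictly lower triangular part `C` of `A`. -/
def strictLower {n : ℕ} (A : Matrix (Fin n) (Fin n) ℝ) : Matrix (Fin n) (Fin n) ℝ :=
  Matrix.of fun i j => if j < i then A i j else 0

/-- The strictly upper triangular part `E` of `A`. -/
def strictUpper {n : ℕ} (A : Matrix (Fin n) (Fin n) ℝ) : Matrix (Fin n) (Fin n) ℝ :=
  Matrix.of fun i j => if i < j then A i j else 0

/-- The Jacobi iteration matrix `B_J = -D⁻¹ (C + E)` of `A = C + D + E`, where `D` is the diagonal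
part of `A` (whose entries are required to be nonzero wherever this is used). -/
def jacobiMatrix {n : ℕ} (A : Matrix (Fin n) (Fin n) ℝ) : Matrix (Fin n) (Fin n) ℝ :=
  -((Matrix.diagonal A.diag)⁻¹ * (strictLower A + strictUpper A))

/-- `(B_1, …, B_d)` is a splitting of `B` of order `d`. -/
structure IsSplitting {n d : ℕ} (B : Matrix (Fin n) (Fin n) ℝ)
    (S : Fin d → Matrix (Fin n) (Fin n) ℝ) : Prop where
  ne_zero : ∀ p, S p ≠ 0
  sum_eq : B = ∑ p, S p
  hadamard_eq_zero : ∀ p q, p ≠ q → Matrix.hadamard (S p) (S q) = 0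

/-- The strictly block lower triangular matrix `𝓛_(d)`: its `(p, q)` block is `B_q` if `q < p` and
`O` otherwise. -/
def blockLower {n d : ℕ} (S : Fin d → Matrix (Fin n) (Fin n) ℝ) :
    Matrix (Fin d × Fin n) (Fin d × Fin n) ℝ :=
  Matrix.of fun x y => if y.1 < x.1 then S y.1 x.2 y.2 else 0

/-- The block upper triangular matrix `𝓤_(d)`: its `(p, q)` block is `B_q` if `p ≤ q` and `O`
otherwise. -/
def blockUpper {n d : ℕ} (S : Fin d → Matrix (Fin n) (Fin n) ℝ) :
    Matrix (Fin d × Fin n) (Fin d × Fin n) ℝ :=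
  Matrix.of fun x y => if x.1 ≤ y.1 then S y.1 x.2 y.2 else 0

/-- `𝓘_(d) - 𝓛_(d)` is always invertible, so the inverse in `iterationMatrix` is a genuine one. -/
theorem det_one_sub_blockLower {n d : ℕ} (S : Fin d → Matrix (Fin n) (Fin n) ℝ) :
    (1 - blockLower S).det = 1 := by
  have h : (1 - blockLower S).transpose.BlockTriangular Prod.fst := by
    intro x y hxy
    have h1 : y ≠ x := by rintro rfl; exact lt_irrefl _ hxy
    simp [blockLower, h1, not_lt.2 (le_of_lt hxy)]
  rw [← Matrix.det_transpose, h.det_fintype]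
  refine Finset.prod_eq_one fun k _ => ?_
  have : (1 - blockLower S).transpose.toSquareBlock Prod.fst k = 1 := by
    ext ⟨x, hx⟩ ⟨y, hy⟩
    simp [Matrix.toSquareBlock_def, blockLower, Matrix.one_apply, hx, hy]
  rw [this, Matrix.det_one]

/-- The iteration matrix `𝓑_(d) = (𝓘_(d) - 𝓛_(d))⁻¹ 𝓤_(d)` of the splitting method. -/
def iterationMatrix {n d : ℕ} (S : Fin d → Matrix (Fin n) (Fin n) ℝ) :
    Matrix (Fin d × Fin n) (Fin d × Fin n) ℝ :=
  (1 - blockLower S)⁻¹ * blockUpper S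

end SplittingMethod

end

/-! Both directions compare nonnegative vectors `v ≠ 0` with `t v ≤ M v`. Such a vector forces `t ≤
ρ(M)`, and the entrywise modulus of an eigenvector supplies one with `t = ρ(M)`, so Perron–Frobenius
is not needed. If `ρ(B_J) ≥ 1`, stacking `d` copies of such a vector for `B_J` yields `ρ(B_J) ≤
ρ(𝓑)`. If `r = ρ(𝓑) ≥ 1`, a weighted maximum over blocks yields `r ^ (1/d) ≤ ρ(B_J)`. Hence `1 ≤`
and `1 <` each transfer both ways, which gives all three equivalences. -/

namespace SplittingMethod

open Matrix Filter

/-! ### Subinvariant vectors and the spectral radius of nonnegative matrices -/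

section Nonnegative

variable {ι : Type*} [Fintype ι]

theorem mulVec_nonneg {M : Matrix ι ι ℝ} (hM : ∀ i j, 0 ≤ M i j) {v : ι → ℝ} (hv : 0 ≤ v) :
    0 ≤ M *ᵥ v :=
  fun i => Finset.sum_nonneg fun j _ => mul_nonneg (hM i j) (hv j)

theorem mulVec_mono_right {M : Matrix ι ι ℝ} (hM : ∀ i j, 0 ≤ M i j) {v w : ι → ℝ} (h : v ≤ w) :
    M *ᵥ v ≤ M *ᵥ w :=
  fun i => Finset.sum_le_sum fun j _ => mul_le_mul_of_nonneg_left (h j) (hM i j)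

theorem pow_smul_le_pow_mulVec [DecidableEq ι] {M : Matrix ι ι ℝ} (hM : ∀ i j, 0 ≤ M i j) {v : ι → ℝ}
    {t : ℝ} (ht : 0 ≤ t) (h : t • v ≤ M *ᵥ v) (k : ℕ) : t ^ k • v ≤ (M ^ k) *ᵥ v := by
  induction k with
  | zero => simp
  | succ k ih =>
    calc t ^ (k + 1) • v = t ^ k • t • v := by rw [smul_smul, pow_succ]
      _ ≤ t ^ k • (M *ᵥ v) := smul_le_smul_of_nonneg_left h (pow_nonneg ht k)
      _ = M *ᵥ (t ^ k • v) := (mulVec_smul _ _ _).symm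
      _ ≤ M *ᵥ ((M ^ k) *ᵥ v) := mulVec_mono_right hM ih
      _ = (M ^ (k + 1)) *ᵥ v := by rw [mulVec_mulVec, pow_succ']

/-- The subinvariance bound of Collatz and Wielandt: if `M ≥ O` and `t v ≤ M v` for some
nonnegative nonzero vector `v`, then `t ≤ ρ(M)`. -/
theorem le_rho_of_smul_le_mulVec [DecidableEq ι] {M : Matrix ι ι ℝ} (hM : ∀ i j, 0 ≤ M i j) {v : ι → ℝ}
    (hv : 0 ≤ v) (hv0 : v ≠ 0) (t : NNReal) (h : (t : ℝ) • v ≤ M *ᵥ v) :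
    (t : ENNReal) ≤ rho M := by
  let _ : NormedRing (Matrix ι ι ℂ) := Matrix.linftyOpNormedRing
  let _ : NormedAlgebra ℂ (Matrix ι ι ℂ) := Matrix.linftyOpNormedAlgebra
  have : CompleteSpace (Matrix ι ι ℂ) := FiniteDimensional.complete ℂ _
  set N : Matrix ι ι ℂ := M.map (algebraMap ℝ ℂ)
  have norm_ofReal (w : ι → ℝ) : ‖(fun i => (w i : ℂ))‖ = ‖w‖ := by
    simp [Pi.norm_def]
  -- Norms of `t ^ k v ≤ M ^ k v` are compared; Gelfand's formula then takes `k`-th roots.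
  have key (k : ℕ) : t ^ k ≤ ‖N ^ k‖₊ := by
    have hpos : 0 < ‖v‖ := norm_pos_iff.2 hv0
    have h1 : ((t : ℝ) ^ k) * ‖v‖ ≤ ‖(M ^ k) *ᵥ v‖ := by
      have h2 := pow_smul_le_pow_mulVec hM t.coe_nonneg h k
      rw [← abs_of_nonneg (pow_nonneg t.coe_nonneg k), ← Real.norm_eq_abs, ← norm_smul]
      refine (pi_norm_le_iff_of_nonneg (norm_nonneg _)).2 fun i => ?_
      have h3 : 0 ≤ (((t : ℝ) ^ k) • v) i := mul_nonneg (pow_nonneg t.coe_nonneg k) (hv i)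
      calc ‖(((t : ℝ) ^ k) • v) i‖ = (((t : ℝ) ^ k) • v) i := abs_of_nonneg h3
        _ ≤ ((M ^ k) *ᵥ v) i := h2 i
        _ ≤ ‖((M ^ k) *ᵥ v) i‖ := le_abs_self _
        _ ≤ _ := norm_le_pi_norm _ i
    have h4 : (fun i => (((M ^ k) *ᵥ v) i : ℂ)) = (N ^ k) *ᵥ (fun i => (v i : ℂ)) := by
      have : N ^ k = (M ^ k).map (algebraMap ℝ ℂ) := (Matrix.map_pow M (algebraMap ℝ ℂ) k).symm
      ext i
      simp [this, mulVec, dotProduct]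
    have h5 : ((t : ℝ) ^ k) * ‖v‖ ≤ ‖N ^ k‖ * ‖v‖ := by
      refine h1.trans ?_
      rw [← norm_ofReal, h4, ← norm_ofReal v]
      exact linfty_opNorm_mulVec _ _
    exact_mod_cast le_of_mul_le_mul_right h5 hpos
  refine ge_of_tendsto (spectrum.pow_nnnorm_pow_one_div_tendsto_nhds_spectralRadius N) ?_
  filter_upwards [eventually_gt_atTop 0] with k hk
  calc (t : ENNReal) = ((t : ENNReal) ^ k) ^ (1 / k : ℝ) := by
        rw [one_div, ENNReal.pow_rpow_inv_natCast hk.ne']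
    _ ≤ _ := ENNReal.rpow_le_rpow (by exact_mod_cast key k) (by positivity)

/-- The spectral radius of `M ≥ O` has a nonnegative subinvariant vector, namely the entrywise
modulus of an eigenvector. -/
theorem exists_rho_smul_le_mulVec [DecidableEq ι] [Nonempty ι] {M : Matrix ι ι ℝ} (hM : ∀ i j, 0 ≤ M i j) :
    ∃ t : NNReal, (t : ENNReal) = rho M ∧
      ∃ v : ι → ℝ, 0 ≤ v ∧ v ≠ 0 ∧ (t : ℝ) • v ≤ M *ᵥ v := by
  let _ : NormedRing (Matrix ι ι ℂ) := Matrix.linftyOpNormedRing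
  let _ : NormedAlgebra ℂ (Matrix ι ι ℂ) := Matrix.linftyOpNormedAlgebra
  have : CompleteSpace (Matrix ι ι ℂ) := FiniteDimensional.complete ℂ _
  obtain ⟨z, hz, hzr⟩ := spectrum.exists_nnnorm_eq_spectralRadius (M.map (algebraMap ℝ ℂ))
  rw [← spectrum_toLin', ← Module.End.hasEigenvalue_iff_mem_spectrum] at hz
  obtain ⟨x, hx⟩ := hz.exists_hasEigenvector
  have hxe := hx.apply_eq_smul
  rw [toLin'_apply] at hxe
  refine ⟨‖z‖₊, hzr, fun i => ‖x i‖, fun i => norm_nonneg _, fun h => hx.2 ?_, fun i => ?_⟩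
  · ext i
    simpa using congrFun h i
  · calc ‖z‖ * ‖x i‖ = ‖(M.map (algebraMap ℝ ℂ) *ᵥ x) i‖ := by rw [hxe]; simp
      _ ≤ ∑ j, ‖M.map (algebraMap ℝ ℂ) i j * x j‖ := norm_sum_le _ _
      _ = (M *ᵥ fun i => ‖x i‖) i := by
        refine Finset.sum_congr rfl fun j _ => ?_
        simp [abs_of_nonneg (hM i j)]

end Nonnegative

/-! ### Comparison of `B_J` with the block iteration matrix -/

section Splitting

variable {n d : ℕ} {B : Matrix (Fin n) (Fin n) ℝ} {S : Fin d → Matrix (Fin n) (Fin n) ℝ}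

/-- The supports are disjoint, so entrywise `S p * B = (S p)²`, which excludes a negative entry of
`S p`. -/
theorem IsSplitting.nonneg (hS : IsSplitting B S) (hB : ∀ i j, 0 ≤ B i j) (p : Fin d)
    (i j : Fin n) : 0 ≤ S p i j := by
  have h : S p i j * B i j = S p i j * S p i j := by
    rw [hS.sum_eq, Matrix.sum_apply, Finset.mul_sum]
    refine Finset.sum_eq_single p (fun q _ hq => ?_) (by simp)
    simpa using congrFun (congrFun (hS.hadamard_eq_zero p q hq.symm) i) j
  by_contra! hneg
  nlinarith [hB i j, mul_pos_of_neg_of_neg hneg hneg,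
    mul_nonpos_of_nonpos_of_nonneg hneg.le (hB i j)]

theorem blockLower_mulVec (x : Fin d × Fin n → ℝ) (p : Fin d) (i : Fin n) :
    (blockLower S *ᵥ x) (p, i) = ∑ q, ∑ j, if q < p then S q i j * x (q, j) else 0 := by
  simp [blockLower, mulVec, dotProduct, Fintype.sum_prod_type]

theorem blockUpper_mulVec (x : Fin d × Fin n → ℝ) (p : Fin d) (i : Fin n) :
    (blockUpper S *ᵥ x) (p, i) = ∑ q, ∑ j, if q < p then 0 else S q i j * x (q, j) := by
  simp only [blockUpper, mulVec, dotProduct, Fintype.sum_prod_type, of_apply, ← not_lt, ite_not,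
    ite_mul, zero_mul]

theorem sum_mulVec_apply (x : Fin n → ℝ) (i : Fin n) :
    ((∑ q, S q) *ᵥ x) i = ∑ q, ∑ j, S q i j * x j := by
  simp only [mulVec, dotProduct, Matrix.sum_apply, Finset.sum_mul]
  exact Finset.sum_comm

theorem iterationMatrix_mulVec_eq (x : Fin d × Fin n → ℝ) :
    iterationMatrix S *ᵥ x =
      blockLower S *ᵥ (iterationMatrix S *ᵥ x) + blockUpper S *ᵥ x := by
  have h : (1 - blockLower S) * iterationMatrix S = blockUpper S :=
    mul_nonsing_inv_cancel_left _ _ (by simp [det_one_sub_blockLower])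
  have h' := congrArg (· *ᵥ x) h
  simp only [← mulVec_mulVec, sub_mulVec, one_mulVec] at h'
  exact sub_eq_iff_eq_add'.1 h'

/-- Forward substitution: block `p` of `𝓛 z` involves only earlier blocks of `z`. This plays the
role of `(𝓘 - 𝓛)⁻¹ ≥ O`. -/
theorem nonneg_of_blockLower_mulVec_le (hS : ∀ p i j, 0 ≤ S p i j) {z : Fin d × Fin n → ℝ}
    (h : blockLower S *ᵥ z ≤ z) : 0 ≤ z := by
  suffices H : ∀ p i, 0 ≤ z (p, i) from fun x => H x.1 x.2
  intro p
  induction p using WellFoundedLT.induction with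
  | ind p ih =>
    intro i
    refine le_trans ?_ (h (p, i))
    rw [blockLower_mulVec]
    refine Finset.sum_nonneg fun q _ => Finset.sum_nonneg fun j _ => ?_
    split_ifs with hq
    · exact mul_nonneg (hS q i j) (ih q hq j)
    · exact le_rfl

theorem blockLower_nonneg (hS : ∀ p i j, 0 ≤ S p i j) (x y : Fin d × Fin n) :
    0 ≤ blockLower S x y := by
  simp only [blockLower, of_apply]
  split_ifs
  exacts [hS _ _ _, le_rfl]

theorem blockUpper_nonneg (hS : ∀ p i j, 0 ≤ S p i j) (x y : Fin d × Fin n) :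
    0 ≤ blockUpper S x y := by
  simp only [blockUpper, of_apply]
  split_ifs
  exacts [hS _ _ _, le_rfl]

theorem iterationMatrix_nonneg (hS : ∀ p i j, 0 ≤ S p i j) (x y : Fin d × Fin n) :
    0 ≤ iterationMatrix S x y := by
  have hu : (0 : Fin d × Fin n → ℝ) ≤ Pi.single y 1 := Pi.single_nonneg.2 zero_le_one
  have h : 0 ≤ iterationMatrix S *ᵥ Pi.single y 1 := by
    refine nonneg_of_blockLower_mulVec_le hS ?_
    conv_rhs => rw [iterationMatrix_mulVec_eq]
    exact le_add_of_nonneg_right (mulVec_nonneg (blockUpper_nonneg hS) hu)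
  simpa using h x

theorem rho_sum_le_rho_iterationMatrix [NeZero d] [NeZero n] (hS : ∀ p i j, 0 ≤ S p i j)
    (h : 1 ≤ rho (∑ p, S p)) : rho (∑ p, S p) ≤ rho (iterationMatrix S) := by
  have hB : ∀ i j, 0 ≤ (∑ p, S p) i j := fun i j => by
    rw [Matrix.sum_apply]
    exact Finset.sum_nonneg fun p _ => hS p i j
  obtain ⟨t, ht, v, hv, hv0, hle⟩ := exists_rho_smul_le_mulVec hB
  rw [← ht] at h ⊢
  have ht1 : (1 : ℝ) ≤ t := by exact_mod_cast h
  set x : Fin d × Fin n → ℝ := fun a => v a.2 with hx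
  have hx0 : 0 ≤ x := fun a => hv a.2
  have hLU : (t : ℝ) • x ≤ blockLower S *ᵥ x + blockUpper S *ᵥ x := by
    rintro ⟨p, i⟩
    refine (hle i).trans_eq ?_
    rw [sum_mulVec_apply, Pi.add_apply, blockLower_mulVec, blockUpper_mulVec,
      ← Finset.sum_add_distrib]
    refine Finset.sum_congr rfl fun q _ => ?_
    rw [← Finset.sum_add_distrib]
    refine Finset.sum_congr rfl fun j _ => ?_
    split_ifs <;> simp [hx]
  refine le_rho_of_smul_le_mulVec (iterationMatrix_nonneg hS) hx0 (fun h0 => hv0 ?_) t ?_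
  · ext i
    exact congrFun h0 (0, i)
  -- For `z = 𝓑 x - t x`, `z - 𝓛 z = 𝓤 x - t x + t 𝓛 x ≥ (t - 1) 𝓛 x ≥ 0`; this is where `t ≥ 1`
  -- enters.
  · refine sub_nonneg.1 (nonneg_of_blockLower_mulVec_le hS fun a => ?_)
    have h1 := congrFun (iterationMatrix_mulVec_eq (S := S) x) a
    have h2 := hLU a
    have h3 : 0 ≤ (blockLower S *ᵥ x) a := mulVec_nonneg (blockLower_nonneg hS) hx0 a
    simp only [mulVec_sub, mulVec_smul, Pi.sub_apply, Pi.smul_apply, Pi.add_apply,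
      smul_eq_mul] at h1 h2 ⊢
    nlinarith

/-- If `r = ρ(𝓑_(d)) ≥ 1`, then `r ^ (1 / d) ≤ ρ(B_J)`. -/
theorem rpow_le_rho_sum [NeZero d] [NeZero n] (hS : ∀ p i j, 0 ≤ S p i j)
    (h : 1 ≤ rho (iterationMatrix S)) :
    rho (iterationMatrix S) ^ (1 / d : ℝ) ≤ rho (∑ p, S p) := by
  have hB : ∀ i j, 0 ≤ (∑ p, S p) i j := fun i j => by
    rw [Matrix.sum_apply]
    exact Finset.sum_nonneg fun p _ => hS p i j
  obtain ⟨r, hr, v, hv, hv0, hle⟩ := exists_rho_smul_le_mulVec (iterationMatrix_nonneg hS)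
  rw [← hr] at h ⊢
  have hr1 : (1 : ℝ) ≤ r := by exact_mod_cast h
  rw [← ENNReal.coe_rpow_of_nonneg _ (by positivity)]
  set s : NNReal := r ^ (1 / d : ℝ) with hs
  have hsd : (s : ℝ) ^ d = r := by
    rw [hs, one_div]
    exact_mod_cast NNReal.rpow_inv_natCast_pow r (NeZero.ne d)
  have hs1 : (1 : ℝ) ≤ s := by
    exact_mod_cast NNReal.one_le_rpow (by exact_mod_cast hr1) (by positivity)
  have hs0 : (0 : ℝ) < s := zero_lt_one.trans_le hs1
  set y := iterationMatrix S *ᵥ v with hy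
  have hy0 : 0 ≤ y := mulVec_nonneg (iterationMatrix_nonneg hS) hv
  have hr0 : (0 : ℝ) < r := zero_lt_one.trans_le hr1
  have hvy (a) : v a ≤ y a / r := (le_div_iff₀' hr0).2 (hle a)
  obtain ⟨⟨p₀, i₀⟩, hpi⟩ : ∃ a, 0 < y a := by
    by_contra! hn
    refine hv0 (funext fun a => le_antisymm ?_ (hv a))
    exact (hvy a).trans (div_nonpos_of_nonpos_of_nonneg (hn a) hr0.le)
  -- The growth `r` of one sweep is spread evenly over the `d` blocks, a factor `s` per block; `m`
  -- is the least vector with `y_p ≤ s ^ p m` for all `p`.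
  set m : Fin n → ℝ := fun i => Finset.univ.sup' Finset.univ_nonempty
    fun p : Fin d => y (p, i) / (s : ℝ) ^ (p : ℕ) 
  have hym' (p i) : y (p, i) / (s : ℝ) ^ (p : ℕ) ≤ m i :=
    Finset.le_sup' (fun p : Fin d => y (p, i) / (s : ℝ) ^ (p : ℕ)) (Finset.mem_univ p)
  have hym (p i) : y (p, i) ≤ (s : ℝ) ^ (p : ℕ) * m i :=
    (div_le_iff₀' (pow_pos hs0 _)).1 (hym' p i)
  have hm0 : 0 ≤ m := fun i => (div_nonneg (hy0 (0, i)) (pow_nonneg hs0.le _)).trans (hym' 0 i)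
  refine le_rho_of_smul_le_mulVec hB hm0 (fun h0 => ?_) s fun i => ?_
  · have := hym p₀ i₀
    rw [h0] at this
    simp only [Pi.zero_apply, mul_zero] at this
    exact absurd hpi this.not_gt
  · rw [Pi.smul_apply, smul_eq_mul, ← le_div_iff₀' hs0]
    refine Finset.sup'_le _ _ fun p _ => ?_
    rw [div_le_div_iff₀ (pow_pos hs0 _) hs0, sum_mulVec_apply, hy, iterationMatrix_mulVec_eq,
      ← hy, Pi.add_apply, blockLower_mulVec, blockUpper_mulVec, ← Finset.sum_add_distrib,
      Finset.sum_mul, Finset.sum_mul]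
    refine Finset.sum_le_sum fun q _ => ?_
    rw [← Finset.sum_add_distrib, Finset.sum_mul, Finset.sum_mul]
    refine Finset.sum_le_sum fun j _ => ?_
    -- The extra factor `s` is absorbed because `q + 1 ≤ p` for updated blocks (`q < p`), and
    -- because `q + 1 ≤ d` for old ones, where `r v ≤ y` gains `r = s ^ d`.
    have hpow {a b : ℕ} (hab : a ≤ b) : (s : ℝ) ^ a ≤ (s : ℝ) ^ b := pow_le_pow_right₀ hs1 hab
    split_ifs with hqp
    · rw [add_zero, mul_assoc, mul_assoc]
      refine mul_le_mul_of_nonneg_left ?_ (hS q i j)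
      calc y (q, j) * s ≤ (s : ℝ) ^ (q : ℕ) * m j * s := mul_le_mul_of_nonneg_right (hym q j) hs0.le
        _ = (s : ℝ) ^ ((q : ℕ) + 1) * m j := by ring
        _ ≤ (s : ℝ) ^ (p : ℕ) * m j := mul_le_mul_of_nonneg_right (hpow hqp) (hm0 j)
        _ = m j * (s : ℝ) ^ (p : ℕ) := mul_comm _ _
    · rw [zero_add, mul_assoc, mul_assoc]
      refine mul_le_mul_of_nonneg_left ?_ (hS q i j)
      refine le_of_mul_le_mul_left ?_ hr0
      calc r * (v (q, j) * s) = r * v (q, j) * s := by ring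
        _ ≤ y (q, j) * s := mul_le_mul_of_nonneg_right (hle (q, j)) hs0.le
        _ ≤ (s : ℝ) ^ (q : ℕ) * m j * s := mul_le_mul_of_nonneg_right (hym q j) hs0.le
        _ = (s : ℝ) ^ ((q : ℕ) + 1) * m j := by ring
        _ ≤ (s : ℝ) ^ (d + (p : ℕ)) * m j :=
          mul_le_mul_of_nonneg_right (hpow (by omega)) (hm0 j)
        _ = r * (m j * (s : ℝ) ^ (p : ℕ)) := by rw [pow_add, hsd]; ring

end Splitting

end SplittingMethod

theorem mainTheorem3 (n d : ℕ) (hd : 2 ≤ d) (A : Matrix (Fin n) (Fin n) ℝ)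
    (hA : ∀ i, A i i ≠ 0)
    (hnonneg : ∀ i j, 0 ≤ SplittingMethod.jacobiMatrix A i j)
    (hrho : 0 < SplittingMethod.rho (SplittingMethod.jacobiMatrix A))
    (S : Fin d → Matrix (Fin n) (Fin n) ℝ)
    (hS : SplittingMethod.IsSplitting (SplittingMethod.jacobiMatrix A) S) :
    (SplittingMethod.rho (SplittingMethod.jacobiMatrix A) < 1 ↔
      SplittingMethod.rho (SplittingMethod.iterationMatrix S) < 1) ∧
    (SplittingMethod.rho (SplittingMethod.jacobiMatrix A) = 1 ↔
      SplittingMethod.rho (SplittingMethod.iterationMatrix S) = 1) ∧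
    (1 < SplittingMethod.rho (SplittingMethod.jacobiMatrix A) ↔
      1 < SplittingMethod.rho (SplittingMethod.iterationMatrix S)) := by
  have hS0 := hS.nonneg hnonneg
  have : NeZero d := ⟨by omega⟩
  have : NeZero n := ⟨by
    rintro rfl
    exact hS.ne_zero 0 (Subsingleton.elim _ _)⟩
  rw [hS.sum_eq]
  have hup := SplittingMethod.rho_sum_le_rho_iterationMatrix hS0
  have hdown := SplittingMethod.rpow_le_rho_sum hS0
  set a := SplittingMethod.rho (∑ p, S p)
  set b := SplittingMethod.rho (SplittingMethod.iterationMatrix S)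
  have hd0 : (0 : ℝ) < 1 / d := one_div_pos.2 (by exact_mod_cast (by omega : 0 < d))
  have hle : 1 ≤ a ↔ 1 ≤ b :=
    ⟨fun h => h.trans (hup h), fun h => (ENNReal.one_le_rpow h hd0).trans (hdown h)⟩
  have hlt : 1 < a ↔ 1 < b :=
    ⟨fun h => h.trans_le (hup h.le), fun h => (ENNReal.one_lt_rpow h hd0).trans_le (hdown h.le)⟩
  refine ⟨by rw [← not_le, ← not_le, hle], ?_, hlt⟩
  rw [le_antisymm_iff, le_antisymm_iff, hle, ← not_lt, hlt, not_lt]
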